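/- An Orlicz function is an even convex function $\Phi:\mathbb R\to[0,\infty)$ with $\Phi(0)=0$ and $\Phi(t)\to\infty$ as $t\to\infty$. It satisfies the $\Delta_2$-condition if there are $a>1$ and $C$ with $\Phi(at)\le C\,\Phi(t)$ for all $t>0$. For $1\le q<\infty$ it is $q$-concave if $t\mapsto\Phi(t^{1/q})$ is concave on $(0,\infty)$. Two Orlicz functions $\Phi,\Psi$ are equivalent if $c\,\Psi\le\Phi\le C\,\Psi$ for some constants $c,C>0$. A noncommutative probability space $(\mathcal M,\tau)$ is a von Neumann algebra $\mathcal M$ on a Hilbert space with a normal faithful trace $\tau$, $\tau(1)=1$. Let $L_0(\mathcal M)$ be the set of closed densely defined operators affiliated with $\mathcal M$, and for $x\in L_0(\mathcal M)$ put $\mu(t,x)=\inf\{s>0:\tau(e_{(s,\infty)}(|x|))\le t\}$, $t>0$, and $\tau(\Phi(|x|))=\int_0^\infty\Phi(\mu(t,x))\,dt\in[0,\infty]$. Here $L_1(\mathcal M)$ and $L_\Phi(\mathcal M)$ consist of the $x\in L_0(\mathcal M)$ with $\mu(\cdot,x)\in L_1(0,1)$, respectively with $\int_0^1\Phi(\mu(t,x)/\lambda)\,dt\le1$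 for some $\lambda>0$. For a sequence $(x_k)_{k\ge0}$ in $L_0(\mathcal M)$ let $X=\sum_k x_k\otimes e_k$ be the diagonal operator over $\mathcal M\bar\otimes\ell_\infty$ with the trace $\tau\otimes\Sigma$, where $\Sigma$ is the counting trace on $\ell_\infty$; thus $\mu(t,X)=\inf\{s>0:\sum_k\tau(e_{(s,\infty)}(|x_k|))\le t\}\in[0,\infty]$ (with $\inf\emptyset=\infty$ and $\Phi(\infty)=\infty$). Let $\mathcal M_0\subset\mathcal M_1\subset\cdots$ be von Neumann subalgebras of $\mathcal M$ with weak$^*$-dense union and $\mathcal E_k$ the $\tau$-preserving conditional expectation onto $\mathcal M_k$. A sequence $(x_k)_{k\ge0}$ is a sequence of martingale differences if $x_k\in L_1(\mathcal M_k)$ for $k\ge0$ and $\mathcal E_{k-1}(x_k)=0$ for $k\ge1$. **Proposition.** Let $\Phi$ be an Orlicz function. Suppose that there is a constant $C$, depending only on $\Phi$, such that for every noncommutative probability space $(\mathcal M,\tau)$ (acting on a Hilbert space) with every such filtration, and every sequence of martingale differences $(x_k)_{k\ge0}\subset L_\Phi(\mathcal M)$ whose series $\sum_k x_k$ converges in $L_1(\mathcal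 M)$, $$\mathbb E\big(\Phi(\mu(X)\chi_{(0,1)})\big)=\int_0^1\Phi(\mu(t,X))\,dt\;\le\; C\,\tau\Big(\Phi\Big(\Big|\sum_{k\ge0}x_k\Big|\Big)\Big),\qquad X=\sum_{k\ge0}x_k\otimes e_k .$$ Then $\Phi$ satisfies the $\Delta_2$-condition, and for some $q\in[1,\infty)$ the function $\Phi$ is $q$-concave up to equivalence, that is, $\Phi$ is equivalent to a $q$-concave Orlicz function. -/

import Mathlib

open Set Filter Topology MeasureTheory
open scoped ENNReal NNReal

noncomputable section

/-! ### Orlicz functions -/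

/-- Orlicz functions: even convex `Φ : ℝ → [0, ∞)` with `Φ 0 = 0` and `Φ(∞) = ∞`. -/
structure IsOrlicz (Φ : ℝ → ℝ) : Prop where
  nonneg : ∀ t, 0 ≤ Φ t
  even : ∀ t, Φ (-t) = Φ t
  convex : ConvexOn ℝ univ Φ
  map_zero : Φ 0 = 0
  tendsto_top : Tendsto Φ atTop atTop

/-- The `Δ₂`-condition: for some `a > 1`, `Φ (a t) ≲ Φ t` for all `t > 0`. -/
def SatisfiesDelta2 (Φ : ℝ → ℝ) : Prop :=
  ∃ a : ℝ, 1 < a ∧ ∃ C : ℝ, ∀ t : ℝ, 0 < t → Φ (a * t) ≤ C * Φ t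

/-- `Φ` is `q`-concave: `t ↦ Φ (t ^ (1 / q))` is concave on `(0, ∞)`. -/
def IsQConcave (q : ℝ) (Φ : ℝ → ℝ) : Prop :=
  ConcaveOn ℝ (Ioi 0) (fun t : ℝ => Φ (t ^ (1 / q)))

/-- Two functions are equivalent if they agree up to positive multiplicative constants. -/
def OrliczEquiv (Φ Ψ : ℝ → ℝ) : Prop :=
  ∃ c C : ℝ, 0 < c ∧ 0 < C ∧ ∀ t : ℝ, c * Ψ t ≤ Φ t ∧ Φ t ≤ C * Ψ t

/-- The extension of `Φ` to `[0, ∞]`, with value `∞` at `∞`. -/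
def orliczExt (Φ : ℝ → ℝ) (u : ℝ≥0∞) : ℝ≥0∞ :=
  if u = ∞ then ∞ else ENNReal.ofReal (Φ u.toReal)

/-! ### Noncommutative probability spaces -/

/-- A noncommutative probability space `(M, τ)`: a von Neumann algebra `M` acting on the Hilbert
space `H` with a normal faithful trace `τ` such that `τ 1 = 1` (so that `M` is finite). -/
structure NCProbSpace (H : Type) [NormedAddCommGroup H] [InnerProductSpace ℂ H]
    [CompleteSpace H] where
  /-- the algebra `M` -/
  alg : VonNeumannAlgebra H
  /-- the trace `τ` -/
  trace : alg.toStarSubalgebra →ₗ[ℂ] ℂ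
  trace_one : trace 1 = 1
  trace_mul_comm : ∀ a b, trace (a * b) = trace (b * a)
  trace_nonneg : ∀ a, 0 ≤ (trace (star a * a)).re ∧ (trace (star a * a)).im = 0
  trace_faithful : ∀ a, trace (star a * a) = 0 → a = 0
  /-- normality: `τ (sup D) = sup τ(D)` for upward directed sets `D` of positive elements -/
  trace_normal : ∀ (D : Set alg.toStarSubalgebra) (a : alg.toStarSubalgebra),
    D.Nonempty → DirectedOn (· ≤ ·) D → (∀ d ∈ D, 0 ≤ d) → IsLUB D a →
      IsLUB ((fun d => (trace d).re) '' D) (trace a).re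

section Operators

variable {H : Type} [NormedAddCommGroup H] [InnerProductSpace ℂ H] [CompleteSpace H]

open scoped Classical in
/-- The trace `τ x` of a bounded operator `x ∈ M` (and `0` for `x ∉ M`). -/
def NCProbSpace.tr (P : NCProbSpace H) (x : H →L[ℂ] H) : ℂ :=
  if hx : x ∈ P.alg.toStarSubalgebra then P.trace ⟨x, hx⟩ else 0

/-- A filtration: an increasing sequence of von Neumann subalgebras `N 0 ≤ N 1 ≤ ⋯` of `M` whose
union is weak-star dense in `M`.  The union is a unital star-subalgebra, so by the bicommutant
theorem its weak-star closure is its double commutant. -/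
structure IsNCFiltration (P : NCProbSpace H) (N : ℕ → VonNeumannAlgebra H) : Prop where
  mono : Monotone N
  le : ∀ k, N k ≤ P.alg
  dense : Set.centralizer (Set.centralizer (⋃ k, (N k : Set (H →L[ℂ] H))))
    = (P.alg : Set (H →L[ℂ] H))

/-- The closed densely defined (possibly unbounded) operators `x` affiliated with the von Neumann
algebra `N`: every `y` in the commutant of `N` satisfies `y x ⊆ x y`.  When `N` carries a finite
trace, each such operator is measurable with respect to that trace, so this is membership
in `L₀(N)`. -/
structure IsAffiliated (N : VonNeumannAlgebra H) (x : H →ₗ.[ℂ] H) : Prop where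
  closed : x.IsClosed
  dense : Dense (x.domain : Set H)
  comm : ∀ y ∈ N.commutant, ∀ p ∈ x.graph, (y p.1, y p.2) ∈ x.graph

/-- The graph of `x`, as a closed subspace of the Hilbert space direct sum `H ⊕ H`
(for closed `x` the topological closure does nothing). -/
abbrev hilbertGraph (x : H →ₗ.[ℂ] H) : Submodule ℂ (WithLp 2 (H × H)) :=
  (x.graph.map
    (WithLp.prodContinuousLinearEquiv 2 ℂ H H).symm.toLinearEquiv.toLinearMap).topologicalClosure

/-- For `x` closed and densely defined, the bounded operator `(1 + x* x)⁻¹`: it is the upper left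
corner of the orthogonal projection of `H ⊕ H` onto the graph of `x`. -/
def graphResolvent (x : H →ₗ.[ℂ] H) : H →L[ℂ] H :=
  WithLp.fstL 2 ℂ H H ∘L (hilbertGraph x).starProjection ∘L
    (WithLp.prodContinuousLinearEquiv 2 ℂ H H).symm.toContinuousLinearMap ∘L
      ContinuousLinearMap.inl ℂ H H

/-- The (right) support projection of a bounded operator `a`: the orthogonal projection onto the
orthogonal complement of the kernel of `a`. -/
def supportProj (a : H →L[ℂ] H) : H →L[ℂ] H :=
  (LinearMap.ker a.toLinearMap)ᗮ.starProjection

/-- The spectral projection `e_{(s,∞)}(|x|)`, `s ≥ 0`, of a closed densely defined operator `x`.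
Since `|x| > s` corresponds to `(1 + x* x)⁻¹ < (1 + s²)⁻¹`, it is the support projection of the
positive part of `(1 + s²)⁻¹ - (1 + x* x)⁻¹`. -/
def specProj (x : H →ₗ.[ℂ] H) (s : ℝ) : H →L[ℂ] H :=
  supportProj ((((1 + s ^ 2 : ℝ)⁻¹ : ℂ) • (1 : H →L[ℂ] H) - graphResolvent x)⁺)

/-- The distribution function `s ↦ τ (e_{(s,∞)}(|x|))`. -/
def distr (P : NCProbSpace H) (x : H →ₗ.[ℂ] H) (s : ℝ) : ℝ≥0∞ :=
  ENNReal.ofReal (P.tr (specProj x s)).re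

/-- The distribution function of the diagonal operator `X = ∑ₖ xₖ ⊗ eₖ` with respect to the
trace `τ ⊗ Σ` on `M ⊗ ℓ_∞`: as `e_{(s,∞)}(|X|) = ∑ₖ e_{(s,∞)}(|xₖ|) ⊗ eₖ`, its trace is the sum of
the `τ (e_{(s,∞)}(|xₖ|))`. -/
def diagDistr (P : NCProbSpace H) (x : ℕ → H →ₗ.[ℂ] H) (s : ℝ) : ℝ≥0∞ :=
  ∑' k, distr P (x k) s

/-- The decreasing function `t ↦ inf {s > 0 : d s ≤ t}` belonging to a distribution function `d`
(the infimum over the empty set being `∞`). -/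
def rearrangement (d : ℝ → ℝ≥0∞) (t : ℝ) : ℝ≥0∞ :=
  ⨅ (s : ℝ) (_ : 0 < s ∧ d s ≤ ENNReal.ofReal t), ENNReal.ofReal s

/-- The generalized singular value function `μ(t, x)` of `x`. -/
def singularValue (P : NCProbSpace H) (x : H →ₗ.[ℂ] H) (t : ℝ) : ℝ≥0∞ :=
  rearrangement (distr P x) t

/-- The generalized singular value function `μ(t, X)` of `X = ∑ₖ xₖ ⊗ eₖ`. -/
def diagSingularValue (P : NCProbSpace H) (x : ℕ → H →ₗ.[ℂ] H) (t : ℝ) : ℝ≥0∞ :=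
  rearrangement (diagDistr P x) t

/-- `τ (Φ(|x|)) = ∫₀^∞ Φ(μ(t, x)) dt`. -/
def traceOrlicz (P : NCProbSpace H) (Φ : ℝ → ℝ) (x : H →ₗ.[ℂ] H) : ℝ≥0∞ :=
  ∫⁻ t in Ioi (0 : ℝ), orliczExt Φ (singularValue P x t)

/-- `𝔼 (Φ(μ(X) χ_(0,1))) = ∫₀¹ Φ(μ(t, X)) dt` for `X = ∑ₖ xₖ ⊗ eₖ`. -/
def headMoment (P : NCProbSpace H) (Φ : ℝ → ℝ) (x : ℕ → H →ₗ.[ℂ] H) : ℝ≥0∞ :=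
  ∫⁻ t in Ioo (0 : ℝ) 1, orliczExt Φ (diagSingularValue P x t)

/-- The `L₁`-norm `τ (|x|) = ∫₀^∞ μ(t, x) dt`. -/
def lOneNorm (P : NCProbSpace H) (x : H →ₗ.[ℂ] H) : ℝ≥0∞ :=
  ∫⁻ t in Ioi (0 : ℝ), singularValue P x t

/-- Membership in `L₁(N)`, for a von Neumann subalgebra `N` of `M`. -/
def MemLOne (P : NCProbSpace H) (N : VonNeumannAlgebra H) (x : H →ₗ.[ℂ] H) : Prop :=
  IsAffiliated N x ∧ lOneNorm P x < ∞

/-- Membership in `L_Φ(M)`: `x ∈ L₀(M)` and `μ(x)` lies in the Orlicz space `L_Φ(0, 1)`, that is,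
`∫₀¹ Φ(μ(t, x) / l) dt ≤ 1` for some `l > 0`. -/
def MemLOrlicz (P : NCProbSpace H) (Φ : ℝ → ℝ) (x : H →ₗ.[ℂ] H) : Prop :=
  IsAffiliated P.alg x ∧ ∃ l : ℝ, 0 < l ∧
    ∫⁻ t in Ioo (0 : ℝ) 1, orliczExt Φ (singularValue P x t / ENNReal.ofReal l) ≤ 1

/-- `τ (a x) = z` for `a ∈ M` and `x ∈ L₁(M)`.  The trace is computed along the bounded truncations
`T n = x e_{[0,n]}(|x|) ∈ M`, which converge to `x` in `L₁(M)`. -/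
def HasTracePairing (P : NCProbSpace H) (a : H →L[ℂ] H) (x : H →ₗ.[ℂ] H) (z : ℂ) : Prop :=
  ∃ T : ℕ → H →L[ℂ] H,
    (∀ (n : ℕ) (ξ : H), (ξ - specProj x n ξ, T n ξ) ∈ x.graph) ∧
      Tendsto (fun n => P.tr (a * T n)) atTop (𝓝 z)

/-- The trace-preserving conditional expectation of `x ∈ L₁(M)` onto the von Neumann subalgebra
`N` vanishes, that is, `τ (a x) = 0` for all `a ∈ N`. -/
def CondExpEqZero (P : NCProbSpace H) (N : VonNeumannAlgebra H) (x : H →ₗ.[ℂ] H) : Prop :=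
  ∀ a ∈ N, HasTracePairing P a x 0

/-- `(xₖ)` is a sequence of martingale differences with respect to the filtration `(N k)`. -/
structure IsMartingaleDiff (P : NCProbSpace H) (N : ℕ → VonNeumannAlgebra H)
    (x : ℕ → H →ₗ.[ℂ] H) : Prop where
  adapted : ∀ k, MemLOne P (N k) (x k)
  condExp : ∀ k, CondExpEqZero P (N k) (x (k + 1))

/-- `∑ₖ xₖ = S`, with convergence of the series in `L₁(M)`.  Sums and differences of unbounded
operators are the strong ones, that is, closures of the algebraic ones. -/
def HasSumLOne (P : NCProbSpace H) (x : ℕ → H →ₗ.[ℂ] H) (S : H →ₗ.[ℂ] H) : Prop :=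
  MemLOne P P.alg S ∧
    Tendsto (fun n => lOneNorm P (S - ∑ k ∈ Finset.range n, x k).closure) atTop (𝓝 0)

end Operators

/-- The lower `Φ`-moment disjointification inequality for all noncommutative martingale
differences, with a constant that depends on `Φ` only. -/
def LowerDisjointification (Φ : ℝ → ℝ) : Prop :=
  ∃ C : ℝ≥0, ∀ (H : Type) [NormedAddCommGroup H] [InnerProductSpace ℂ H] [CompleteSpace H]
    (P : NCProbSpace H) (N : ℕ → VonNeumannAlgebra H) (x : ℕ → H →ₗ.[ℂ] H) (S : H →ₗ.[ℂ] H),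
    IsNCFiltration P N → IsMartingaleDiff P N x → (∀ k, MemLOrlicz P Φ (x k)) →
      HasSumLOne P x S → headMoment P Φ x ≤ C * traceOrlicz P Φ S

end

/-!
The disjointification inequality implies the `Δ₂`-condition because the differences of a bounded
martingale can be larger than its limit.  On three points of mass `1 / 3`, the martingale that
starts at `r / 3` and jumps to `r`, `r`, `-r` has a limit of absolute value `r`, but its jump equals
`-4 r / 3` with probability `1 / 3`.  The inequality therefore gives `Φ (4 r / 3) ≤ 3 C Φ r` with
`C` independent of `r` (`LowerDisjointification.satisfiesDelta2`).  The martingale is realized by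
diagonal operators in the algebra `B(ℂ³)` with its normalized trace (`matrixSpace`), filtered by
the scalars and then the whole algebra; all quantities reduce to the explicit form of the spectral
projections of a diagonal operator (`specProj_diagPMap`).

The `Δ₂`-condition and convexity make `s ↦ Φ s / s ^ q` decreasing
for some `q` (`IsOrlicz.exists_le_rpow_mul`).  The function `Ψ t = ∫₀ᵗ Φ s / s ds` is then
equivalent to `Φ`.  It is convex since `Φ s / s` is increasing, and `q`-concave since
the derivative of `Ψ (t ^ (1 / q))` is `Φ u / (q u ^ q)` with `u = t ^ (1 / q)`.
-/

/-! ### Orlicz functions satisfying the `Δ₂`-condition -/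

namespace IsOrlicz

variable {Φ : ℝ → ℝ}

lemma continuous (hΦ : IsOrlicz Φ) : Continuous Φ :=
  continuousOn_univ.1 (hΦ.convex.continuousOn isOpen_univ)

lemma map_mul_le (hΦ : IsOrlicz Φ) {r t : ℝ} (hr : 0 ≤ r) (hr1 : r ≤ 1) :
    Φ (r * t) ≤ r * Φ t := by
  have := hΦ.convex.2 (mem_univ t) (mem_univ 0) hr (sub_nonneg.2 hr1) (by ring)
  simpa [hΦ.map_zero] using this

lemma monotoneOn (hΦ : IsOrlicz Φ) : MonotoneOn Φ (Ici 0) := by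
  intro s hs t ht hst
  rcases (mem_Ici.1 ht).eq_or_lt with rfl | ht0
  · rw [le_antisymm hst hs]
  have hr : s / t ≤ 1 := (div_le_one ht0).2 hst
  have := hΦ.map_mul_le (t := t) (div_nonneg hs ht) hr
  rw [div_mul_cancel₀ _ ht0.ne'] at this
  exact this.trans (mul_le_of_le_one_left (hΦ.nonneg t) hr)

/-- The odd function `s ↦ Φ s / s`, whose primitive is a smoothing of `Φ`, is increasing. -/
lemma monotone_div_self (hΦ : IsOrlicz Φ) : Monotone fun s => Φ s / s := by
  have key : ∀ s t : ℝ, 0 < s → s ≤ t → Φ s / s ≤ Φ t / t := by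
    intro s t hs hst
    have ht := hs.trans_le hst
    have := hΦ.map_mul_le (t := t) (div_nonneg hs.le ht.le) ((div_le_one ht).2 hst)
    rw [div_mul_cancel₀ _ ht.ne'] at this
    rw [div_le_iff₀ hs]
    calc Φ s ≤ s / t * Φ t := this
      _ = Φ t / t * s := by ring
  intro s t hst
  dsimp only
  rcases lt_or_ge 0 s with hs | hs
  · exact key s t hs hst
  rcases lt_or_ge t 0 with ht | ht
  · have := key (-t) (-s) (neg_pos.2 ht) (neg_le_neg hst)
    rw [hΦ.even, hΦ.even, div_neg, div_neg] at this
    exact neg_le_neg_iff.1 this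
  · exact (div_nonpos_of_nonneg_of_nonpos (hΦ.nonneg s) hs).trans (div_nonneg (hΦ.nonneg t) ht)

/-- Under the `Δ₂`-condition `s ↦ Φ s / s ^ q` is decreasing on `(0, ∞)` for large `q`.  For
`s ≤ t ≤ a s` this is convexity combined with Bernoulli's inequality; the general case follows by
iteration. -/
lemma exists_le_rpow_mul (hΦ : IsOrlicz Φ) (h : SatisfiesDelta2 Φ) :
    ∃ q : ℝ, 1 ≤ q ∧ ∀ s t : ℝ, 0 < s → s ≤ t → Φ t ≤ (t / s) ^ q * Φ s := by
  obtain ⟨a, ha, K, hK⟩ := h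
  refine ⟨max 1 ((K - 1) / (a - 1)), le_max_left _ _, ?_⟩
  set q := max 1 ((K - 1) / (a - 1)) with hq
  have ha1 : 0 < a - 1 := sub_pos.2 ha
  have a0 : 0 < a := by linarith
  have step : ∀ s t : ℝ, 0 < s → s ≤ t → t ≤ a * s → Φ t ≤ (t / s) ^ q * Φ s := by
    intro s t hs hst hta
    -- `t` is the convex combination of `s` and `a s` with weight `θ` on `a s`
    set θ := (t / s - 1) / (a - 1) with hθ
    have h1 : 1 ≤ t / s := (one_le_div hs).2 hst
    have h2 : t / s ≤ a := (div_le_iff₀ hs).2 hta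
    have θ0 : 0 ≤ θ := div_nonneg (by linarith) ha1.le
    have θ1 : θ ≤ 1 := (div_le_one ha1).2 (by linarith)
    have hmul : θ * (a - 1) = t / s - 1 := div_mul_cancel₀ _ ha1.ne'
    have hts : t / s * s = t := div_mul_cancel₀ _ hs.ne'
    have hc := hΦ.convex.2 (mem_univ s) (mem_univ (a * s)) (sub_nonneg.2 θ1) θ0 (by ring)
    have hpt : (1 - θ) • s + θ • (a * s) = t := by
      simp only [smul_eq_mul]
      linear_combination s * hmul + hts
    rw [hpt] at hc
    simp only [smul_eq_mul] at hc
    have hB := one_add_mul_self_le_rpow_one_add (s := t / s - 1) (by linarith)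
      (le_max_left 1 _ : 1 ≤ q)
    rw [add_sub_cancel] at hB
    have h3 : θ * (K - 1) ≤ q * (t / s - 1) := by
      have : θ * (K - 1) = (K - 1) / (a - 1) * (t / s - 1) := by rw [hθ]; ring
      rw [this]
      exact mul_le_mul_of_nonneg_right (le_max_right _ _) (by linarith)
    calc Φ t ≤ (1 - θ) * Φ s + θ * (K * Φ s) :=
          hc.trans (by gcongr; exact hK s hs)
      _ = (1 + θ * (K - 1)) * Φ s := by ring
      _ ≤ (t / s) ^ q * Φ s := mul_le_mul_of_nonneg_right (by linarith) (hΦ.nonneg s)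
  have iter : ∀ n : ℕ, ∀ s t : ℝ, 0 < s → s ≤ t → t ≤ a ^ n * s → Φ t ≤ (t / s) ^ q * Φ s := by
    intro n
    induction n with
    | zero => exact fun s t hs hst h => step s t hs hst (h.trans (by nlinarith))
    | succ n ih =>
      intro s t hs hst h
      rcases le_total t (a * s) with h' | h'
      · exact step s t hs hst h'
      have has : 0 < a * s := by positivity
      have h1 := ih (a * s) t has h' (by rw [pow_succ] at h; linarith)
      have h2 := step s (a * s) hs (by nlinarith) le_rfl
      have ht : 0 < t := hs.trans_le hst
      calc Φ t ≤ (t / (a * s)) ^ q * ((a * s / s) ^ q * Φ s) := h1.trans (by gcongr)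
        _ = (t / s) ^ q * Φ s := by
          rw [← mul_assoc, ← Real.mul_rpow (by positivity) (by positivity)]
          have : t / (a * s) * (a * s / s) = t / s := by field_simp
          rw [this]
  intro s t hs hst
  obtain ⟨n, hn⟩ := pow_unbounded_of_one_lt (t / s) ha
  exact iter n s t hs hst ((div_le_iff₀ hs).1 hn.le)

end IsOrlicz

/-- The primitive `t ↦ ∫₀ᵗ Φ s / s ds`, for an Orlicz function `Φ` a smoothed version of `Φ`.  For
even `Φ` the integrand is odd, so that no absolute value is needed for negative `t`. -/
noncomputable def logPrimitive (Φ : ℝ → ℝ) (t : ℝ) : ℝ :=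
  ∫ s in (0 : ℝ)..t, Φ s / s

namespace IsOrlicz

variable {Φ : ℝ → ℝ}

lemma intervalIntegrable_div_self (hΦ : IsOrlicz Φ) (a b : ℝ) :
    IntervalIntegrable (fun s => Φ s / s) volume a b :=
  hΦ.monotone_div_self.intervalIntegrable

lemma logPrimitive_neg (hΦ : IsOrlicz Φ) (t : ℝ) : logPrimitive Φ (-t) = logPrimitive Φ t := by
  have h := intervalIntegral.integral_comp_neg (fun s => Φ s / s) (a := 0) (b := t)
  simp only [hΦ.even, div_neg, neg_zero, intervalIntegral.integral_neg] at h
  rw [logPrimitive, logPrimitive, intervalIntegral.integral_symm, ← h, neg_neg]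

lemma logPrimitive_sub (hΦ : IsOrlicz Φ) (a b : ℝ) :
    logPrimitive Φ b - logPrimitive Φ a = ∫ s in a..b, Φ s / s :=
  intervalIntegral.integral_interval_sub_left (hΦ.intervalIntegrable_div_self _ _)
    (hΦ.intervalIntegrable_div_self _ _)

lemma logPrimitive_sub_le (hΦ : IsOrlicz Φ) {a b : ℝ} (hab : a ≤ b) :
    logPrimitive Φ b - logPrimitive Φ a ≤ (b - a) * (Φ b / b) := by
  rw [hΦ.logPrimitive_sub]
  have := intervalIntegral.integral_mono_on hab (hΦ.intervalIntegrable_div_self a b)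
    (intervalIntegrable_const (c := Φ b / b)) fun s hs => hΦ.monotone_div_self hs.2
  rwa [intervalIntegral.integral_const, smul_eq_mul] at this

lemma le_logPrimitive_sub (hΦ : IsOrlicz Φ) {a b : ℝ} (hab : a ≤ b) :
    (b - a) * (Φ a / a) ≤ logPrimitive Φ b - logPrimitive Φ a := by
  rw [hΦ.logPrimitive_sub]
  have := intervalIntegral.integral_mono_on hab
    (intervalIntegrable_const (c := Φ a / a)) (hΦ.intervalIntegrable_div_self a b)
    fun s hs => hΦ.monotone_div_self hs.1
  rwa [intervalIntegral.integral_const, smul_eq_mul] at this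

lemma convexOn_logPrimitive (hΦ : IsOrlicz Φ) : ConvexOn ℝ univ (logPrimitive Φ) := by
  refine convexOn_of_slope_mono_adjacent convex_univ fun {x y z} _ _ hxy hyz => ?_
  calc _ ≤ Φ y / y := by
        rw [div_le_iff₀ (sub_pos.2 hxy), mul_comm]; exact hΦ.logPrimitive_sub_le hxy.le
    _ ≤ _ := by
        rw [le_div_iff₀ (sub_pos.2 hyz), mul_comm]; exact hΦ.le_logPrimitive_sub hyz.le

lemma logPrimitive_le (hΦ : IsOrlicz Φ) {t : ℝ} (ht : 0 ≤ t) : logPrimitive Φ t ≤ Φ t := by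
  rcases ht.eq_or_lt with rfl | ht
  · simp [logPrimitive, hΦ.map_zero]
  have := hΦ.logPrimitive_sub_le ht.le
  rw [sub_zero, mul_div_cancel₀ _ ht.ne'] at this
  simpa [logPrimitive] using this

lemma logPrimitive_nonneg (hΦ : IsOrlicz Φ) (t : ℝ) : 0 ≤ logPrimitive Φ t := by
  have key : ∀ t, 0 ≤ t → 0 ≤ logPrimitive Φ t := fun t ht => by
    simpa [logPrimitive] using hΦ.le_logPrimitive_sub ht
  rcases le_total 0 t with ht | ht
  · exact key t ht
  · rw [← hΦ.logPrimitive_neg]; exact key _ (neg_nonneg.2 ht)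

/-- Integrate the bound `Φ s / s ≥ Φ t / t ^ q * s ^ (q - 1)` over `(0, t)`. -/
lemma div_le_logPrimitive (hΦ : IsOrlicz Φ) {q : ℝ} (hq : 1 ≤ q)
    (h : ∀ s t : ℝ, 0 < s → s ≤ t → Φ t ≤ (t / s) ^ q * Φ s) {t : ℝ} (ht : 0 ≤ t) :
    Φ t / q ≤ logPrimitive Φ t := by
  rcases ht.eq_or_lt with rfl | ht
  · simp [logPrimitive, hΦ.map_zero]
  have hle : ∫ s in (0 : ℝ)..t, Φ t / t ^ q * s ^ (q - 1) ≤ logPrimitive Φ t := by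
    refine intervalIntegral.integral_mono_on_of_le_Ioo ht.le
      ((intervalIntegral.intervalIntegrable_rpow' (by linarith)).const_mul _)
      (hΦ.intervalIntegrable_div_self _ _) fun s hs => ?_
    have hs0 : 0 < s := hs.1
    have := h s t hs0 hs.2.le
    rw [Real.div_rpow ht.le hs0.le] at this
    have htq : 0 < t ^ q := Real.rpow_pos_of_pos ht q
    have hsq : 0 < s ^ q := Real.rpow_pos_of_pos hs0 q
    rw [Real.rpow_sub_one hs0.ne', mul_div_assoc', div_le_div_iff_of_pos_right hs0]
    rw [div_mul_eq_mul_div, div_le_iff₀ htq, ← le_div_iff₀ hsq]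
    calc Φ t ≤ t ^ q / s ^ q * Φ s := this
      _ = _ := by ring
  refine le_trans (le_of_eq ?_) hle
  have htq : t ^ q ≠ 0 := (Real.rpow_pos_of_pos ht q).ne'
  rw [intervalIntegral.integral_const_mul, integral_rpow (Or.inl (by linarith)), sub_add_cancel,
    Real.zero_rpow (by linarith), sub_zero]
  field_simp

lemma hasDerivAt_logPrimitive (hΦ : IsOrlicz Φ) {t : ℝ} (ht : 0 < t) :
    HasDerivAt (logPrimitive Φ) (Φ t / t) t := by
  have hm : Measurable fun s => Φ s / s := hΦ.continuous.measurable.div measurable_id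
  exact intervalIntegral.integral_hasDerivAt_right (hΦ.intervalIntegrable_div_self 0 t)
    hm.stronglyMeasurable.stronglyMeasurableAtFilter
    (hΦ.continuous.continuousAt.div continuousAt_id ht.ne')

/-- In the variable `u = t ^ (1 / q)` the derivative of `t ↦ logPrimitive Φ (t ^ (1 / q))` is
`Φ u / (q u ^ q)`, which is decreasing. -/
lemma isQConcave_logPrimitive (hΦ : IsOrlicz Φ) {q : ℝ} (hq : 1 ≤ q)
    (h : ∀ s t : ℝ, 0 < s → s ≤ t → Φ t ≤ (t / s) ^ q * Φ s) :
    IsQConcave q (logPrimitive Φ) := by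
  have hq0 : 0 < q := by linarith
  have hd : ∀ t ∈ Ioi (0 : ℝ), HasDerivAt (fun t : ℝ => logPrimitive Φ (t ^ (1 / q)))
      (Φ (t ^ (1 / q)) / t / q) t := by
    intro t ht
    have ht : 0 < t := ht
    have hu : 0 < t ^ (1 / q) := Real.rpow_pos_of_pos ht _
    have := (hΦ.hasDerivAt_logPrimitive hu).comp t
      (Real.hasDerivAt_rpow_const (p := 1 / q) (Or.inl ht.ne'))
    refine this.congr_deriv ?_
    rw [Real.rpow_sub_one ht.ne']
    field_simp
  refine AntitoneOn.concaveOn_of_deriv (convex_Ioi 0)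
    (fun t ht => (hd t ht).continuousAt.continuousWithinAt)
    (fun t ht => (hd t (interior_subset ht)).differentiableAt.differentiableWithinAt) ?_
  rw [interior_Ioi]
  intro s hs t ht hst
  rw [(hd s hs).deriv, (hd t ht).deriv]
  have hs : 0 < s := hs
  have ht : 0 < t := ht
  have := h (s ^ (1 / q)) (t ^ (1 / q)) (Real.rpow_pos_of_pos hs _)
    (Real.rpow_le_rpow hs.le hst (by positivity))
  rw [← Real.div_rpow ht.le hs.le, ← Real.rpow_mul (by positivity), one_div_mul_cancel hq0.ne',
    Real.rpow_one] at this
  gcongr ?_ / q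
  rw [div_le_iff₀ ht]
  exact this.trans (le_of_eq (by ring))

lemma isOrlicz_logPrimitive (hΦ : IsOrlicz Φ) {q : ℝ} (hq : 1 ≤ q)
    (h : ∀ s t : ℝ, 0 < s → s ≤ t → Φ t ≤ (t / s) ^ q * Φ s) : IsOrlicz (logPrimitive Φ) where
  nonneg := hΦ.logPrimitive_nonneg
  even := hΦ.logPrimitive_neg
  convex := hΦ.convexOn_logPrimitive
  map_zero := by simp [logPrimitive]
  tendsto_top := tendsto_atTop_mono' _
    ((eventually_ge_atTop 0).mono fun _ ht => hΦ.div_le_logPrimitive hq h ht)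
    (hΦ.tendsto_top.atTop_div_const (by linarith))

/-- An Orlicz function with the `Δ₂`-condition is `q`-concave up to equivalence for some `q`. -/
theorem exists_isQConcave_equiv (hΦ : IsOrlicz Φ) (h : SatisfiesDelta2 Φ) :
    ∃ q : ℝ, 1 ≤ q ∧ ∃ Ψ : ℝ → ℝ, IsOrlicz Ψ ∧ IsQConcave q Ψ ∧ OrliczEquiv Φ Ψ := by
  obtain ⟨q, hq, hle⟩ := hΦ.exists_le_rpow_mul h
  have hq0 : 0 < q := by linarith
  have key : ∀ t, 0 ≤ t → 1 * logPrimitive Φ t ≤ Φ t ∧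
      Φ t ≤ q * logPrimitive Φ t := fun t ht =>
    ⟨by simpa using hΦ.logPrimitive_le ht,
      by simpa [mul_comm] using (div_le_iff₀ hq0).1 (hΦ.div_le_logPrimitive hq hle ht)⟩
  refine ⟨q, hq, _, hΦ.isOrlicz_logPrimitive hq hle, hΦ.isQConcave_logPrimitive hq hle, 1, q,
    one_pos, hq0, fun t => ?_⟩
  rcases le_total 0 t with ht | ht
  · exact key t ht
  · have := key (-t) (neg_nonneg.2 ht)
    rwa [hΦ.even, hΦ.logPrimitive_neg] at this

end IsOrlicz

/-! ### Diagonal operators and their spectral projections -/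

section Diagonal

variable {ι : Type} [Fintype ι] [DecidableEq ι]

/-- The operator on `ℂ^ι` that multiplies the `i`-th coordinate by the real number `d i`. -/
noncomputable def diagOp (d : ι → ℝ) : EuclideanSpace ℂ ι →L[ℂ] EuclideanSpace ℂ ι :=
  Matrix.toEuclideanCLM (𝕜 := ℂ) (Matrix.diagonal fun i => (d i : ℂ))

@[simp]
lemma diagOp_apply (d : ι → ℝ) (ξ : EuclideanSpace ℂ ι) (i : ι) :
    diagOp d ξ i = d i * ξ i := by
  rw [diagOp, Matrix.ofLp_toEuclideanCLM, Matrix.mulVec_diagonal]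

lemma diagOp_mul (d e : ι → ℝ) : diagOp d * diagOp e = diagOp fun i => d i * e i := by
  ext ξ i; simp [mul_assoc]

lemma diagOp_sub (d e : ι → ℝ) : diagOp d - diagOp e = diagOp fun i => d i - e i := by
  ext ξ i; simp [sub_mul]

lemma diagOp_const (c : ℝ) : diagOp (fun _ : ι => c) = (c : ℂ) • 1 := by
  ext ξ i; simp

lemma star_diagOp (d : ι → ℝ) : star (diagOp d) = diagOp d := by
  rw [diagOp, ← map_star, Matrix.star_eq_conjTranspose, Matrix.diagonal_conjTranspose]
  congr 2
  ext i
  simp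

lemma diagOp_nonneg {d : ι → ℝ} (hd : ∀ i, 0 ≤ d i) : 0 ≤ diagOp d := by
  have : diagOp d = star (diagOp fun i => √(d i)) * diagOp fun i => √(d i) := by
    rw [star_diagOp, diagOp_mul]
    simp only [Real.mul_self_sqrt (hd _)]
  rw [this]
  exact star_mul_self_nonneg _

lemma posPart_diagOp (d : ι → ℝ) : (diagOp d)⁺ = diagOp fun i => (d i)⁺ := by
  refine (CFC.posPart_negPart_unique (c := diagOp fun i => (d i)⁻) ?_ ?_
    (diagOp_nonneg fun i => posPart_nonneg _) (diagOp_nonneg fun i => negPart_nonneg _)).1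
  · simp only [diagOp_sub, posPart_sub_negPart]
  · ext ξ i
    rcases le_total (d i) 0 with h | h <;> simp [diagOp_mul, h]

lemma supportProj_diagOp (d : ι → ℝ) :
    supportProj (diagOp d) = diagOp fun i => if d i = 0 then 0 else 1 := by
  ext1 ξ
  refine Submodule.eq_starProjection_of_mem_orthogonal ?_ ?_
  · rw [Submodule.mem_orthogonal]
    intro w hw
    rw [PiLp.inner_apply]
    refine Finset.sum_eq_zero fun i _ => ?_
    have : diagOp d w i = 0 := by rw [show diagOp d w = 0 from hw]; rfl
    rw [diagOp_apply, mul_eq_zero, Complex.ofReal_eq_zero] at this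
    rcases this with h | h <;> simp [h]
  · refine Submodule.le_orthogonal_orthogonal _ ?_
    change diagOp d _ = 0
    ext i
    by_cases h : d i = 0 <;> simp [h]

/-- The diagonal operator `diagOp d`, regarded as an everywhere defined partial operator. -/
noncomputable def diagPMap (d : ι → ℝ) : EuclideanSpace ℂ ι →ₗ.[ℂ] EuclideanSpace ℂ ι :=
  (diagOp d).toLinearMap.toPMap ⊤

lemma mem_graph_diagPMap {d : ι → ℝ} {p : EuclideanSpace ℂ ι × EuclideanSpace ℂ ι} :
    p ∈ (diagPMap d).graph ↔ p.2 = diagOp d p.1 := by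
  rw [LinearPMap.mem_graph_iff]
  constructor
  · rintro ⟨y, hy, h⟩
    rw [← h, ← hy]; rfl
  · exact fun h => ⟨⟨p.1, trivial⟩, rfl, h.symm⟩

lemma isClosed_diagPMap (d : ι → ℝ) : (diagPMap d).IsClosed :=
  Submodule.closed_of_finiteDimensional _

lemma closure_diagPMap (d : ι → ℝ) : (diagPMap d).closure = diagPMap d := by
  refine LinearPMap.eq_of_eq_graph ?_
  rw [← (isClosed_diagPMap d).isClosable.graph_closure_eq_closure_graph]
  exact IsClosed.submodule_topologicalClosure_eq (isClosed_diagPMap d)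

lemma diagPMap_sub (d e : ι → ℝ) : diagPMap d - diagPMap e = diagPMap fun i => d i - e i := by
  refine LinearPMap.ext (by simp [diagPMap, LinearPMap.sub_domain]) fun x hx hx' => ?_
  change diagOp d x - diagOp e x = diagOp _ x
  rw [← diagOp_sub]; rfl

lemma diagPMap_zero : diagPMap (fun _ : ι => 0) = 0 := by
  refine LinearPMap.ext rfl fun x hx hx' => ?_
  change diagOp _ x = 0
  ext i; simp

lemma diagPMap_add (d e : ι → ℝ) : diagPMap d + diagPMap e = diagPMap fun i => d i + e i := by
  refine LinearPMap.ext (by simp [diagPMap, LinearPMap.add_domain]) fun x hx hx' => ?_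
  change diagOp d x + diagOp e x = diagOp _ x
  ext i; simp [add_mul]

lemma sum_diagPMap (d : ℕ → ι → ℝ) (s : Finset ℕ) :
    ∑ k ∈ s, diagPMap (d k) = diagPMap fun i => ∑ k ∈ s, d k i := by
  induction s using Finset.cons_induction with
  | empty => simp [diagPMap_zero]
  | cons k s hk ih => simp only [Finset.sum_cons, ih, diagPMap_add]

lemma mem_hilbertGraph_diagPMap {d : ι → ℝ}
    {w : WithLp 2 (EuclideanSpace ℂ ι × EuclideanSpace ℂ ι)} :
    w ∈ hilbertGraph (diagPMap d) ↔ w.snd = diagOp d w.fst := by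
  constructor
  · intro hw
    have hc : IsClosed {w : WithLp 2 (EuclideanSpace ℂ ι × EuclideanSpace ℂ ι) |
        WithLp.sndL 2 ℂ _ _ w = diagOp d (WithLp.fstL 2 ℂ _ _ w)} :=
      isClosed_eq (ContinuousLinearMap.continuous _)
        ((diagOp d).continuous.comp (ContinuousLinearMap.continuous _))
    refine closure_minimal ?_ hc hw
    rintro _ ⟨p, hp, rfl⟩
    exact mem_graph_diagPMap.1 hp
  · intro h
    refine Submodule.le_topologicalClosure _ ⟨(w.fst, w.snd), mem_graph_diagPMap.2 h, rfl⟩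

/-- The orthogonal projection of `(ξ, 0)` onto the graph of `D = diagOp d` is `(u, D u)`, where
`u = (1 + D²)⁻¹ ξ`. -/
lemma graphResolvent_diagPMap (d : ι → ℝ) :
    graphResolvent (diagPMap d) = diagOp fun i => (1 + d i ^ 2)⁻¹ := by
  ext1 ξ
  set u := diagOp (fun i => (1 + d i ^ 2)⁻¹) ξ with hu
  have key : (hilbertGraph (diagPMap d)).starProjection (WithLp.toLp 2 (ξ, 0))
      = WithLp.toLp 2 (u, diagOp d u) := by
    refine Submodule.eq_starProjection_of_mem_of_inner_eq_zero
      (mem_hilbertGraph_diagPMap.2 rfl) fun w hw => ?_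
    have hv := mem_hilbertGraph_diagPMap.1 hw
    rw [WithLp.prod_inner_apply, PiLp.inner_apply, PiLp.inner_apply, ← Finset.sum_add_distrib]
    refine Finset.sum_eq_zero fun i _ => ?_
    have h : (1 + (d i : ℂ) ^ 2) ≠ 0 := by
      exact_mod_cast (by positivity : (1 + d i ^ 2 : ℝ) ≠ 0)
    have h1 : (WithLp.toLp 2 (ξ, (0 : EuclideanSpace ℂ ι)) -
        WithLp.toLp 2 (u, diagOp d u)).ofLp.1 i = ξ i - (1 + (d i : ℂ) ^ 2)⁻¹ * ξ i := by simp [hu]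
    have h2 : (WithLp.toLp 2 (ξ, (0 : EuclideanSpace ℂ ι)) -
        WithLp.toLp 2 (u, diagOp d u)).ofLp.2 i =
          -(d i * ((1 + (d i : ℂ) ^ 2)⁻¹ * ξ i)) := by simp [hu]
    have h3 : w.ofLp.2 i = d i * w.ofLp.1 i := by
      rw [← diagOp_apply]; exact congrArg (fun z => z i) hv
    rw [h1, h2, h3]
    simp only [RCLike.inner_apply, map_sub, map_neg, map_mul, map_inv₀, map_add, map_one, map_pow,
      Complex.conj_ofReal]
    field_simp
    ring
  change ((hilbertGraph (diagPMap d)).starProjection (WithLp.toLp 2 (ξ, 0))).fst = u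
  rw [key]
  rfl

lemma specProj_diagPMap (d : ι → ℝ) {s : ℝ} (hs : 0 ≤ s) :
    specProj (diagPMap d) s = diagOp fun i => if s < |d i| then 1 else 0 := by
  have h : ((((1 + s ^ 2 : ℝ)⁻¹ : ℂ)) • (1 : EuclideanSpace ℂ ι →L[ℂ] EuclideanSpace ℂ ι))
      = diagOp fun _ => (1 + s ^ 2)⁻¹ := by
    rw [diagOp_const, Complex.ofReal_inv]
  rw [specProj, graphResolvent_diagPMap, h, diagOp_sub, posPart_diagOp, supportProj_diagOp]
  congr 1
  ext i
  have : ((1 + s ^ 2)⁻¹ - (1 + d i ^ 2)⁻¹)⁺ = 0 ↔ ¬ s < |d i| := by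
    rw [posPart_eq_zero, sub_nonpos, inv_le_inv₀ (by positivity) (by positivity),
      add_le_add_iff_left, not_lt, sq_le_sq, abs_of_nonneg hs]
  by_cases h' : s < |d i| <;> simp [this, h']

end Diagonal

/-! ### The matrix algebra with its normalized trace -/

section MatrixSpace

variable {ι : Type} [Fintype ι]

variable (ι) in
/-- The normalized trace on `B(ℂ^ι)`. -/
noncomputable def normTrace :
    (EuclideanSpace ℂ ι →L[ℂ] EuclideanSpace ℂ ι) →ₗ[ℂ] ℂ :=
  (Fintype.card ι : ℂ)⁻¹ • (LinearMap.trace ℂ (EuclideanSpace ℂ ι) ∘ₗ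
    ContinuousLinearMap.coeLM ℂ)

lemma normTrace_mul_comm (a b : EuclideanSpace ℂ ι →L[ℂ] EuclideanSpace ℂ ι) :
    normTrace ι (a * b) = normTrace ι (b * a) := by
  have := LinearMap.trace_mul_comm ℂ (a.toLinearMap : Module.End ℂ (EuclideanSpace ℂ ι))
    b.toLinearMap
  exact congrArg (fun z => (Fintype.card ι : ℂ)⁻¹ * z) this

variable [DecidableEq ι]

lemma normTrace_apply (a : EuclideanSpace ℂ ι →L[ℂ] EuclideanSpace ℂ ι) :
    normTrace ι a = (Fintype.card ι : ℂ)⁻¹ *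
      ∑ i, inner ℂ (EuclideanSpace.single i (1 : ℂ)) (a (EuclideanSpace.single i 1)) := by
  have := LinearMap.trace_eq_sum_inner a.toLinearMap (EuclideanSpace.basisFun ι ℂ)
  simp only [EuclideanSpace.basisFun_apply] at this
  simpa [normTrace] using congrArg (fun z => (Fintype.card ι : ℂ)⁻¹ * z) this

lemma normTrace_mono {a b : EuclideanSpace ℂ ι →L[ℂ] EuclideanSpace ℂ ι} (hab : a ≤ b) :
    (normTrace ι a).re ≤ (normTrace ι b).re := by
  rw [← sub_nonneg, ← Complex.sub_re, ← map_sub, normTrace_apply, ← Complex.ofReal_natCast,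
    ← Complex.ofReal_inv, Complex.re_ofReal_mul, Complex.re_sum]
  exact mul_nonneg (by positivity) (Finset.sum_nonneg fun i _ =>
    (RCLike.nonneg_iff.1 (((ContinuousLinearMap.le_def a b).1 hab).inner_nonneg_right _)).1)

lemma normTrace_star_mul_self (a : EuclideanSpace ℂ ι →L[ℂ] EuclideanSpace ℂ ι) :
    normTrace ι (star a * a) =
      (((Fintype.card ι : ℝ)⁻¹ * ∑ i, ‖a (EuclideanSpace.single i 1)‖ ^ 2 : ℝ) : ℂ) := by
  rw [normTrace_apply]
  push_cast
  congr 1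
  refine Finset.sum_congr rfl fun i _ => ?_
  rw [ContinuousLinearMap.star_eq_adjoint]
  exact (ContinuousLinearMap.adjoint_inner_right _ _ _).trans (inner_self_eq_norm_sq_to_K _)

/-- The trace on matrices is normal: by compactness of the order interval `[d₀, a]`, the elements
of a bounded directed set whose traces are at most `b` have a common upper bound of trace at
most `b`. -/
lemma normTrace_isLUB {D : Set (EuclideanSpace ℂ ι →L[ℂ] EuclideanSpace ℂ ι)}
    {a : EuclideanSpace ℂ ι →L[ℂ] EuclideanSpace ℂ ι} (hne : D.Nonempty)
    (hdir : DirectedOn (· ≤ ·) D) (h0 : ∀ d ∈ D, 0 ≤ d) (ha : IsLUB D a) :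
    IsLUB ((fun d => (normTrace ι d).re) '' D) (normTrace ι a).re := by
  constructor
  · rintro _ ⟨d, hd, rfl⟩
    exact normTrace_mono (ha.1 hd)
  intro b hb
  have hcont : Continuous fun c => (normTrace ι c).re :=
    Complex.continuous_re.comp (LinearMap.continuous_of_finiteDimensional (normTrace ι))
  have hclosed : ∀ d, IsClosed (Icc d a ∩ {c | (normTrace ι c).re ≤ b}) := fun d =>
    isClosed_Icc.inter (isClosed_le hcont continuous_const)
  have : Nonempty D := hne.to_subtype
  have hmeet : (⋂ d : D, Icc (d : EuclideanSpace ℂ ι →L[ℂ] EuclideanSpace ℂ ι) a ∩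
      {c | (normTrace ι c).re ≤ b}).Nonempty := by
    refine IsCompact.nonempty_iInter_of_directed_nonempty_isCompact_isClosed _ ?_ ?_ ?_
      fun d => hclosed d
    · rintro ⟨d, hd⟩ ⟨e, he⟩
      obtain ⟨f, hf, hdf, hef⟩ := hdir d hd e he
      exact ⟨⟨f, hf⟩, inter_subset_inter_left _ (Icc_subset_Icc_left hdf),
        inter_subset_inter_left _ (Icc_subset_Icc_left hef)⟩
    · rintro ⟨d, hd⟩
      exact ⟨d, ⟨le_rfl, ha.1 hd⟩, hb ⟨d, hd, rfl⟩⟩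
    · rintro ⟨d, hd⟩
      refine Metric.isCompact_of_isClosed_isBounded (hclosed d)
        ((Metric.isBounded_closedBall (x := 0) (r := ‖a‖)).subset fun c hc => ?_)
      rw [mem_closedBall_zero_iff]
      exact CStarAlgebra.norm_le_norm_of_nonneg_of_le ((h0 d hd).trans hc.1.1) hc.1.2
  obtain ⟨c, hc⟩ := hmeet
  rw [mem_iInter] at hc
  obtain ⟨d, hd⟩ := hne
  exact (normTrace_mono (ha.2 fun d hd => (hc ⟨d, hd⟩).1.1)).trans (hc ⟨d, hd⟩).2

lemma normTrace_diagOp (d : ι → ℝ) :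
    normTrace ι (diagOp d) = (((Fintype.card ι : ℝ)⁻¹ * ∑ i, d i : ℝ) : ℂ) := by
  rw [normTrace_apply]
  simp [EuclideanSpace.inner_single_left]

variable [Nonempty ι]

lemma normTrace_one : normTrace ι 1 = 1 := by
  have : (Fintype.card ι : ℂ) ≠ 0 := Nat.cast_ne_zero.2 Fintype.card_ne_zero
  simp [normTrace_apply, this]

lemma eq_zero_of_normTrace_star_mul_self {a : EuclideanSpace ℂ ι →L[ℂ] EuclideanSpace ℂ ι}
    (ha : normTrace ι (star a * a) = 0) : a = 0 := by
  have hι : (Fintype.card ι : ℝ)⁻¹ ≠ 0 := inv_ne_zero (Nat.cast_ne_zero.2 Fintype.card_ne_zero)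
  rw [normTrace_star_mul_self, Complex.ofReal_eq_zero, mul_eq_zero, or_iff_right hι,
    Finset.sum_eq_zero_iff_of_nonneg fun _ _ => sq_nonneg _] at ha
  refine ContinuousLinearMap.coe_injective
    ((EuclideanSpace.basisFun ι ℂ).toBasis.ext fun i => ?_)
  simpa using ha i (Finset.mem_univ i)

/-- The von Neumann algebra `B(H)` of all bounded operators. -/
noncomputable def fullAlgebra (H : Type) [NormedAddCommGroup H] [InnerProductSpace ℂ H]
    [CompleteSpace H] : VonNeumannAlgebra H where
  toStarSubalgebra := ⊤
  centralizer_centralizer' := eq_univ_of_forall fun x _ hy => (hy x (mem_univ x)).symm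

lemma isLUB_image_val_fullAlgebra {H : Type} [NormedAddCommGroup H] [InnerProductSpace ℂ H]
    [CompleteSpace H] {D : Set (fullAlgebra H).toStarSubalgebra}
    {a : (fullAlgebra H).toStarSubalgebra} (ha : IsLUB D a) :
    IsLUB (Subtype.val '' D) (a : H →L[ℂ] H) := by
  refine ⟨?_, fun b hb => ?_⟩
  · rintro _ ⟨d, hd, rfl⟩
    exact ha.1 hd
  · have hb' : (⟨b, mem_univ b⟩ : (fullAlgebra H).toStarSubalgebra) ∈ upperBounds D :=
      fun d hd => hb ⟨d, hd, rfl⟩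
    exact ha.2 hb'

variable (ι) in
/-- The algebra `B(ℂ^ι)` of all operators, with its normalized trace. -/
noncomputable def matrixSpace : NCProbSpace (EuclideanSpace ℂ ι) where
  alg := fullAlgebra _
  trace := normTrace ι ∘ₗ
    (fullAlgebra (EuclideanSpace ℂ ι)).toStarSubalgebra.subtype.toAlgHom.toLinearMap
  trace_one := normTrace_one
  trace_mul_comm _ _ := normTrace_mul_comm _ _
  trace_nonneg a := by
    have h : normTrace ι (star a.1 * a.1) = _ := normTrace_star_mul_self _
    change 0 ≤ (normTrace ι (star a.1 * a.1)).re ∧ (normTrace ι (star a.1 * a.1)).im = 0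
    rw [h, Complex.ofReal_re, Complex.ofReal_im]
    exact ⟨by positivity, rfl⟩
  trace_faithful a ha := Subtype.ext (eq_zero_of_normTrace_star_mul_self ha)
  trace_normal D a hne hdir h0 ha := by
    have := normTrace_isLUB (D := Subtype.val '' D) (a := a.1) (hne.image _) ?_ ?_
      (isLUB_image_val_fullAlgebra ha)
    · rwa [image_image] at this
    · rintro _ ⟨d, hd, rfl⟩ _ ⟨e, he, rfl⟩
      obtain ⟨f, hf, hdf, hef⟩ := hdir d hd e he
      exact ⟨f, ⟨f, hf, rfl⟩, hdf, hef⟩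
    · rintro _ ⟨d, hd, rfl⟩
      exact h0 d hd

lemma mem_matrixSpace_alg (a : EuclideanSpace ℂ ι →L[ℂ] EuclideanSpace ℂ ι) :
    a ∈ (matrixSpace ι).alg :=
  mem_univ a

lemma matrixSpace_tr (a : EuclideanSpace ℂ ι →L[ℂ] EuclideanSpace ℂ ι) :
    (matrixSpace ι).tr a = normTrace ι a := by
  rw [NCProbSpace.tr, dif_pos (show a ∈ (matrixSpace ι).alg.toStarSubalgebra from mem_univ a)]
  rfl

/-- Operators in the commutant of `B(ℂ^ι)` are scalar, so that they pair to zero with diagonal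
operators of trace zero. -/
lemma normTrace_mul_diagOp_eq_zero {a : EuclideanSpace ℂ ι →L[ℂ] EuclideanSpace ℂ ι}
    (ha : a ∈ (matrixSpace ι).alg.commutant) {d : ι → ℝ} (hd : ∑ i, d i = 0) :
    normTrace ι (a * diagOp d) = 0 := by
  rw [VonNeumannAlgebra.mem_commutant_iff] at ha
  obtain ⟨j⟩ := ‹Nonempty ι›
  set z : ℂ := inner ℂ (EuclideanSpace.single j (1 : ℂ)) (a (EuclideanSpace.single j 1)) with hz
  -- `a` commutes with the operator `|ξ⟩⟨e_j|`; apply both products to `e_j`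
  have hscal : ∀ ξ, a ξ = z • ξ := by
    intro ξ
    have := ha (InnerProductSpace.rankOne ℂ ξ (EuclideanSpace.single j 1))
      (mem_matrixSpace_alg _)
    have := congrArg (fun b => b (EuclideanSpace.single j (1 : ℂ))) this
    simpa [InnerProductSpace.rankOne_apply, hz] using this.symm
  have : a * diagOp d = z • diagOp d := by
    ext1 ξ
    exact hscal _
  rw [this, map_smul, normTrace_diagOp, hd]
  simp

end MatrixSpace

/-! ### Singular values of diagonal operators -/

lemma rearrangement_le {d : ℝ → ℝ≥0∞} {s t : ℝ} (hs : 0 < s) (h : d s ≤ ENNReal.ofReal t) :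
    rearrangement d t ≤ ENNReal.ofReal s :=
  iInf₂_le (f := fun (s : ℝ) (_ : 0 < s ∧ d s ≤ ENNReal.ofReal t) => ENNReal.ofReal s) s ⟨hs, h⟩

lemma le_rearrangement {d : ℝ → ℝ≥0∞} {c t : ℝ}
    (h : ∀ s, 0 < s → s < c → ENNReal.ofReal t < d s) :
    ENNReal.ofReal c ≤ rearrangement d t :=
  le_iInf₂ fun s hs => ENNReal.ofReal_le_ofReal <|
    le_of_not_gt fun hsc => (h s hs.1 hsc).not_ge hs.2

/-- It suffices that the distribution function is at most `t` on `(m, ∞)`. -/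
lemma rearrangement_le_of_forall_gt {d : ℝ → ℝ≥0∞} {m t : ℝ} (hm : 0 ≤ m)
    (h : ∀ s, m < s → d s ≤ ENNReal.ofReal t) : rearrangement d t ≤ ENNReal.ofReal m := by
  refine ENNReal.le_of_forall_pos_le_add fun ε hε _ => ?_
  have hε : (0 : ℝ) < ε := hε
  refine (rearrangement_le (by linarith) (h (m + ε) (by linarith))).trans (le_of_eq ?_)
  rw [ENNReal.ofReal_add hm hε.le, ENNReal.ofReal_coe_nnreal]

lemma orliczExt_ofReal (Φ : ℝ → ℝ) {c : ℝ} (hc : 0 ≤ c) :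
    orliczExt Φ (ENNReal.ofReal c) = ENNReal.ofReal (Φ c) := by
  rw [orliczExt, if_neg ENNReal.ofReal_ne_top, ENNReal.toReal_ofReal hc]

lemma IsOrlicz.orliczExt_mono {Φ : ℝ → ℝ} (hΦ : IsOrlicz Φ) : Monotone (orliczExt Φ) := by
  intro u v huv
  by_cases hv : v = ∞
  · simp [orliczExt, hv]
  have hu : u ≠ ∞ := (huv.trans_lt (lt_top_iff_ne_top.2 hv)).ne
  rw [orliczExt, orliczExt, if_neg hu, if_neg hv]
  exact ENNReal.ofReal_le_ofReal (hΦ.monotoneOn ENNReal.toReal_nonneg ENNReal.toReal_nonneg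
    (ENNReal.toReal_mono hv huv))

lemma IsOrlicz.orliczExt_zero {Φ : ℝ → ℝ} (hΦ : IsOrlicz Φ) : orliczExt Φ 0 = 0 := by
  simp [orliczExt, hΦ.map_zero]

section Diagonal

variable {ι : Type} [Fintype ι] {Φ : ℝ → ℝ} {d : ι → ℝ}

lemma exists_abs_le (d : ι → ℝ) : ∃ m, 0 < m ∧ ∀ i, |d i| ≤ m :=
  ⟨1 + ∑ i, |d i|, by positivity, fun i =>
    (Finset.single_le_sum (f := fun i => |d i|) (fun _ _ => abs_nonneg _)
      (Finset.mem_univ i)).trans (by linarith)⟩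

variable [DecidableEq ι]

/-- A diagonal operator belonging to a von Neumann subalgebra is affiliated with it. -/
lemma isAffiliated_diagPMap {N : VonNeumannAlgebra (EuclideanSpace ℂ ι)} (h : diagOp d ∈ N) :
    IsAffiliated N (diagPMap d) where
  closed := isClosed_diagPMap d
  dense := dense_univ
  comm y hy p hp := by
    rw [mem_graph_diagPMap] at hp ⊢
    have := congrArg (fun b => b p.1) (VonNeumannAlgebra.mem_commutant_iff.1 hy _ h)
    exact (congrArg y hp).trans this.symm

variable [Nonempty ι]

lemma distr_diagPMap (d : ι → ℝ) {s : ℝ} (hs : 0 ≤ s) :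
    distr (matrixSpace ι) (diagPMap d) s =
      ENNReal.ofReal ((Fintype.card ι : ℝ)⁻¹ * ∑ i, if s < |d i| then 1 else 0) := by
  rw [distr, specProj_diagPMap d hs, matrixSpace_tr, normTrace_diagOp, Complex.ofReal_re]

lemma distr_diagPMap_le_one (d : ι → ℝ) {s : ℝ} (hs : 0 ≤ s) :
    distr (matrixSpace ι) (diagPMap d) s ≤ 1 := by
  rw [distr_diagPMap d hs, ← ENNReal.ofReal_one]
  refine ENNReal.ofReal_le_ofReal ?_
  have : (0 : ℝ) < Fintype.card ι := Nat.cast_pos.2 Fintype.card_pos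
  rw [inv_mul_le_iff₀ this, mul_one]
  calc (∑ i, if s < |d i| then 1 else 0 : ℝ) ≤ ∑ _i : ι, (1 : ℝ) :=
        Finset.sum_le_sum fun i _ => by split_ifs <;> norm_num
    _ = Fintype.card ι := by simp

lemma singularValue_diagPMap_le {m : ℝ} (hm : 0 ≤ m) (hd : ∀ i, |d i| ≤ m) (t : ℝ) :
    singularValue (matrixSpace ι) (diagPMap d) t ≤ ENNReal.ofReal m := by
  refine rearrangement_le_of_forall_gt hm fun s hs => ?_
  rw [distr_diagPMap d (hm.trans hs.le)]
  simp [fun i => ((hd i).trans hs.le).not_gt]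

lemma singularValue_diagPMap_eq_zero (d : ι → ℝ) {t : ℝ} (ht : 1 ≤ t) :
    singularValue (matrixSpace ι) (diagPMap d) t = 0 := by
  refine le_antisymm ?_ bot_le
  rw [← ENNReal.ofReal_zero]
  refine rearrangement_le_of_forall_gt le_rfl fun s hs => ?_
  exact (distr_diagPMap_le_one d hs.le).trans (ENNReal.one_le_ofReal.2 ht)

/-- An integral over `(0, ∞)` of a monotone function of the singular values, which vanish beyond
`1`, is controlled by a bound on the operator. -/
lemma lintegral_singularValue_diagPMap_le {f : ℝ≥0∞ → ℝ≥0∞} (hf : Monotone f) (hf0 : f 0 = 0)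
    {m : ℝ} (hm : 0 ≤ m) (hd : ∀ i, |d i| ≤ m) :
    ∫⁻ t in Ioi (0 : ℝ), f (singularValue (matrixSpace ι) (diagPMap d) t)
      ≤ f (ENNReal.ofReal m) := by
  calc ∫⁻ t in Ioi (0 : ℝ), f (singularValue (matrixSpace ι) (diagPMap d) t)
      ≤ ∫⁻ t in Ioi (0 : ℝ), (Ioo 0 1).indicator (fun _ => f (ENNReal.ofReal m)) t := by
        refine setLIntegral_mono' measurableSet_Ioi fun t ht => ?_
        by_cases h : t < 1
        · rw [indicator_of_mem (show t ∈ Ioo 0 1 from ⟨ht, h⟩)]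
          exact hf (singularValue_diagPMap_le hm hd t)
        · rw [singularValue_diagPMap_eq_zero d (not_lt.1 h), hf0]
          exact bot_le
    _ ≤ ∫⁻ t, (Ioo (0 : ℝ) 1).indicator (fun _ => f (ENNReal.ofReal m)) t :=
        setLIntegral_le_lintegral _ _
    _ = f (ENNReal.ofReal m) := by
        rw [lintegral_indicator_const measurableSet_Ioo]; simp

lemma lOneNorm_diagPMap_le {m : ℝ} (hm : 0 ≤ m) (hd : ∀ i, |d i| ≤ m) :
    lOneNorm (matrixSpace ι) (diagPMap d) ≤ ENNReal.ofReal m :=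
  lintegral_singularValue_diagPMap_le monotone_id rfl hm hd

lemma traceOrlicz_diagPMap_le (hΦ : IsOrlicz Φ) {m : ℝ} (hm : 0 ≤ m) (hd : ∀ i, |d i| ≤ m) :
    traceOrlicz (matrixSpace ι) Φ (diagPMap d) ≤ ENNReal.ofReal (Φ m) :=
  (lintegral_singularValue_diagPMap_le hΦ.orliczExt_mono hΦ.orliczExt_zero hm hd).trans_eq
    (orliczExt_ofReal Φ hm)

lemma memLOne_diagPMap {N : VonNeumannAlgebra (EuclideanSpace ℂ ι)} (h : diagOp d ∈ N) :
    MemLOne (matrixSpace ι) N (diagPMap d) := by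
  obtain ⟨m, hm, hd⟩ := exists_abs_le d
  exact ⟨isAffiliated_diagPMap h, (lOneNorm_diagPMap_le hm.le hd).trans_lt ENNReal.ofReal_lt_top⟩

lemma memLOrlicz_diagPMap (hΦ : IsOrlicz Φ) (d : ι → ℝ) :
    MemLOrlicz (matrixSpace ι) Φ (diagPMap d) := by
  obtain ⟨m, hm, hd⟩ := exists_abs_le d
  refine ⟨isAffiliated_diagPMap (mem_matrixSpace_alg _), ?_⟩
  -- convexity gives `Φ ε ≤ ε Φ 1 ≤ 1`
  set ε : ℝ := (1 + Φ 1)⁻¹ with hε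
  have h1 := hΦ.nonneg 1
  have hε0 : 0 < ε := by positivity
  have hΦε : Φ ε ≤ 1 := by
    have := hΦ.map_mul_le (t := 1) hε0.le (inv_le_one_of_one_le₀ (by linarith))
    rw [mul_one] at this
    refine this.trans ?_
    rw [hε, inv_mul_le_iff₀ (by positivity)]
    linarith
  have hl : 0 < m / ε := by positivity
  refine ⟨m / ε, hl, ?_⟩
  calc _ ≤ ∫⁻ _ in Ioo (0 : ℝ) 1, 1 := by
        refine lintegral_mono fun t => ?_
        have : singularValue (matrixSpace ι) (diagPMap d) t / ENNReal.ofReal (m / ε)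
            ≤ ENNReal.ofReal ε := by
          refine ENNReal.div_le_of_le_mul ?_
          rw [← ENNReal.ofReal_mul hε0.le, mul_div_cancel₀ _ hε0.ne']
          exact singularValue_diagPMap_le hm.le hd t
        refine (hΦ.orliczExt_mono this).trans ?_
        rw [orliczExt_ofReal Φ hε0.le]
        exact ENNReal.ofReal_le_one.2 hΦε
    _ = 1 := by simp

lemma condExpEqZero_diagPMap (hd : ∑ i, d i = 0) :
    CondExpEqZero (matrixSpace ι) (matrixSpace ι).alg.commutant (diagPMap d) := by
  intro a ha
  refine ⟨fun n => diagOp d * (1 - specProj (diagPMap d) n), fun n ξ => ?_, ?_⟩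
  · exact mem_graph_diagPMap.2 rfl
  obtain ⟨m, hm, hdm⟩ := exists_abs_le d
  refine tendsto_const_nhds.congr' ?_
  filter_upwards [eventually_ge_atTop ⌈m⌉₊] with n hn
  have hmn : m ≤ n := (Nat.le_ceil m).trans (Nat.cast_le.2 hn)
  have h0 : specProj (diagPMap d) n = 0 := by
    rw [specProj_diagPMap d n.cast_nonneg]
    ext ξ i
    simp [((hdm i).trans hmn).not_gt]
  rw [h0, sub_zero, mul_one, matrixSpace_tr, normTrace_mul_diagOp_eq_zero ha hd]

end Diagonal

/-! ### A martingale with large differences -/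

/-- The filtration `ℂ1 ⊂ B(ℂ^ι) = B(ℂ^ι) = ⋯`; the scalars appear as the commutant of `B(ℂ^ι)`. -/
noncomputable def scalarThenFull (ι : Type) [Fintype ι] [DecidableEq ι] [Nonempty ι] :
    ℕ → VonNeumannAlgebra (EuclideanSpace ℂ ι)
  | 0 => (matrixSpace ι).alg.commutant
  | _ + 1 => (matrixSpace ι).alg

lemma isNCFiltration_scalarThenFull (ι : Type) [Fintype ι] [DecidableEq ι] [Nonempty ι] :
    IsNCFiltration (matrixSpace ι) (scalarThenFull ι) where
  mono := monotone_nat_of_le_succ fun _ a _ => mem_matrixSpace_alg a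
  le _ a _ := mem_matrixSpace_alg a
  dense := by
    have h : (⋃ k, (scalarThenFull ι k : Set (EuclideanSpace ℂ ι →L[ℂ] EuclideanSpace ℂ ι)))
        = (matrixSpace ι).alg :=
      (eq_univ_of_forall fun a => mem_iUnion.2 ⟨1, mem_matrixSpace_alg a⟩).trans
        (eq_univ_of_forall mem_matrixSpace_alg).symm
    rw [h, VonNeumannAlgebra.centralizer_centralizer]

/-- Martingale differences on three points of mass `1 / 3`: the martingale starts at `r / 3` and
then jumps to `r`, `r`, `-r` and stays there. -/
noncomputable def jumpDiff (r : ℝ) : ℕ → Fin 3 → ℝ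
  | 0 => fun _ => r / 3
  | 1 => ![2 * r / 3, 2 * r / 3, -(4 * r / 3)]
  | _ + 2 => fun _ => 0

lemma sum_range_jumpDiff (r : ℝ) (n : ℕ) (i : Fin 3) :
    ∑ k ∈ Finset.range (n + 2), jumpDiff r k i = ![r, r, -r] i := by
  rw [Finset.sum_range_succ', Finset.sum_range_succ']
  have : ∑ k ∈ Finset.range n, jumpDiff r (k + 1 + 1) i = 0 := Finset.sum_eq_zero fun _ _ => rfl
  rw [this]
  fin_cases i <;> simp [jumpDiff] <;> ring

lemma isMartingaleDiff_jumpDiff (r : ℝ) :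
    IsMartingaleDiff (matrixSpace (Fin 3)) (scalarThenFull (Fin 3))
      (fun k => diagPMap (jumpDiff r k)) where
  adapted k := by
    refine memLOne_diagPMap ?_
    rcases k with _ | k
    · refine VonNeumannAlgebra.mem_commutant_iff.2 fun a _ => ?_
      rw [jumpDiff, diagOp_const]
      simp
    · exact mem_matrixSpace_alg _
  condExp k := by
    have hsum : ∑ i, jumpDiff r (k + 1) i = 0 := by
      rcases k with _ | k
      · simp [jumpDiff, Fin.sum_univ_three]; ring
      · simp [jumpDiff]
    rcases k with _ | k
    · exact condExpEqZero_diagPMap hsum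
    · -- the later differences are zero, so that any `a` pairs to zero with them
      intro a _
      refine ⟨fun _ => 0, fun n ξ => mem_graph_diagPMap.2 ?_, ?_⟩
      · ext i; simp [jumpDiff]
      · simp [matrixSpace_tr]

lemma hasSumLOne_jumpDiff (r : ℝ) :
    HasSumLOne (matrixSpace (Fin 3)) (fun k => diagPMap (jumpDiff r k))
      (diagPMap ![r, r, -r]) := by
  refine ⟨memLOne_diagPMap (mem_matrixSpace_alg _), tendsto_const_nhds.congr' ?_⟩
  filter_upwards [eventually_ge_atTop 2] with n hn
  obtain ⟨n, rfl⟩ := Nat.exists_eq_add_of_le' hn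
  rw [sum_diagPMap, diagPMap_sub, closure_diagPMap]
  refine (le_antisymm ((lOneNorm_diagPMap_le le_rfl fun i => ?_).trans_eq
    ENNReal.ofReal_zero) bot_le).symm
  rw [sum_range_jumpDiff, sub_self, abs_zero]

/-- Up to time `1 / 3` the singular values of the diagonal operator are at least `4 r / 3`, the
largest value of the difference at time `1`. -/
lemma le_headMoment_jumpDiff {Φ : ℝ → ℝ} (hΦ : IsOrlicz Φ) {r : ℝ} (hr : 0 < r) :
    ENNReal.ofReal (Φ (4 / 3 * r)) * ENNReal.ofReal (1 / 3) ≤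
      headMoment (matrixSpace (Fin 3)) Φ (fun k => diagPMap (jumpDiff r k)) := by
  have hdistr : ∀ s, 0 < s → s < 4 / 3 * r → ENNReal.ofReal (1 / 3) ≤
      diagDistr (matrixSpace (Fin 3)) (fun k => diagPMap (jumpDiff r k)) s := by
    intro s hs hsr
    refine le_trans ?_ (ENNReal.le_tsum 1)
    rw [distr_diagPMap _ hs.le]
    refine ENNReal.ofReal_le_ofReal ?_
    have h : s < |jumpDiff r 1 2| := by
      have : |jumpDiff r 1 2| = 4 * r / 3 := by
        rw [show jumpDiff r 1 2 = -(4 * r / 3) from rfl, abs_neg, abs_of_pos (by positivity)]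
      linarith
    have := Finset.single_le_sum (f := fun i => if s < |jumpDiff r 1 i| then (1 : ℝ) else 0)
      (fun i _ => by split_ifs <;> norm_num) (Finset.mem_univ (2 : Fin 3))
    simp only [if_pos h] at this
    rw [Fintype.card_fin, one_div, Nat.cast_ofNat]
    exact le_mul_of_one_le_right (by norm_num) this
  calc _ = ∫⁻ _ in Ioo (0 : ℝ) (1 / 3), ENNReal.ofReal (Φ (4 / 3 * r)) := by simp
    _ ≤ ∫⁻ t in Ioo (0 : ℝ) (1 / 3), orliczExt Φ (diagSingularValue (matrixSpace (Fin 3))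
          (fun k => diagPMap (jumpDiff r k)) t) := by
        refine setLIntegral_mono' measurableSet_Ioo fun t ht => ?_
        rw [← orliczExt_ofReal Φ (by positivity)]
        refine hΦ.orliczExt_mono (le_rearrangement fun s hs hsr => ?_)
        exact ((ENNReal.ofReal_lt_ofReal_iff (by norm_num)).2 ht.2).trans_le (hdistr s hs hsr)
    _ ≤ _ := lintegral_mono_set (Ioo_subset_Ioo_right (by norm_num))

/-- The sum of the differences `jumpDiff r` has absolute value `r`, while a difference of absolute
value `4 r / 3` occurs with probability `1 / 3`; hence `Φ (4 r / 3) ≤ 3 C Φ r`. -/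
theorem LowerDisjointification.satisfiesDelta2 {Φ : ℝ → ℝ} (hΦ : IsOrlicz Φ)
    (h : LowerDisjointification Φ) : SatisfiesDelta2 Φ := by
  obtain ⟨C, hC⟩ := h
  refine ⟨4 / 3, by norm_num, 3 * C, fun r hr => ?_⟩
  have hle := (le_headMoment_jumpDiff hΦ hr).trans <|
    (hC _ _ _ _ _ (isNCFiltration_scalarThenFull (Fin 3)) (isMartingaleDiff_jumpDiff r)
      (fun k => memLOrlicz_diagPMap hΦ _) (hasSumLOne_jumpDiff r)).trans <|
    mul_le_mul_right (traceOrlicz_diagPMap_le hΦ hr.le fun i => by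
      fin_cases i <;> simp [abs_of_pos hr]) _
  rw [← ENNReal.ofReal_mul (hΦ.nonneg _), ← ENNReal.ofReal_coe_nnreal,
    ← ENNReal.ofReal_mul C.coe_nonneg,
    ENNReal.ofReal_le_ofReal_iff (mul_nonneg C.coe_nonneg (hΦ.nonneg _))] at hle
  linarith

theorem proposition6p5 (Φ : ℝ → ℝ) (hΦ : IsOrlicz Φ) (h : LowerDisjointification Φ) :
    SatisfiesDelta2 Φ ∧
      ∃ q : ℝ, 1 ≤ q ∧ ∃ Ψ : ℝ → ℝ, IsOrlicz Ψ ∧ IsQConcave q Ψ ∧ OrliczEquiv Φ Ψ :=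
  ⟨h.satisfiesDelta2 hΦ, hΦ.exists_isQConcave_equiv (h.satisfiesDelta2 hΦ)⟩
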